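/- **Notation.** Let $k,t\ge 0$. For a commutative ring $S$ with unity and $n\ge1$, let $T_n^{(d)}$ ($d\in\mathbb Z$) be the $n\times n$ matrix over $S$ with $(i,j)$ entry $1$ if $j-i=d$ and $0$ otherwise, let $P_n$ be the $n\times n$ matrix with $(i,j)$ entry $1$ if $j-i\equiv 1 \pmod n$ and $0$ otherwise, and let $J_k$ be the $k\times k$ matrix of ones. The permanent of a square matrix is denoted $\operatorname{per}$, and for an $m\times n$ matrix $A=(a_{i,j})$ over $S$ $$R(x;A)=1+\sum_{s=1}^{m}x^s\sum_{\substack{I\subseteq\{1,\dots,m\}\\|I|=s}}\ \sum_{\sigma: I\hookrightarrow\{1,\dots,n\}}\ \prod_{i\in I}a_{i,\sigma(i)}$$ is its rook polynomial ($\sigma$ runs over the injections of $I$ into $\{1,\dots,n\}$). Write $i^{\langle l\rangle}$ for $i$ repeated $l$ times. Let $G_t^{[k]}$ be the set of vectors $(1^{\langle l_1\rangle},2^{\langle l_2\rangle},\dots,t^{\langle l_t\rangle})$ with $0\le l_i\le k$, and let $G_{r,t}^{[k]}$ be the set of those with $l_1+\dots+l_t=r$. For a vector $\gamma$ let $\{\gamma\}$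 be the multiset of its components. The matrix $K_t^{[k]}(b_0,\dots,b_t)$, with rows and columns indexed by $G_t^{[k]}$, is defined as follows. $K_0^{[k]}(b_0)=\sum_{d=0}^k d!\binom kd^2b_0^d$. If $t\ge1$ and $\alpha=(1^{\langle l_1\rangle},\dots,t^{\langle l_t\rangle})$, its entry at $(\alpha,\beta)$ is $$\prod_{i=1}^{t-1}\binom{l_i}{p_i}\cdot\binom k{v-p}\,b_0^{\,v-p}\,b_1^{p_1}\cdots b_{t-1}^{p_{t-1}}\sum_{d=0}^{\min(l_t,k-v)}(d+v)!\binom k{d+v}\binom{l_t}d b_t^d,\qquad p=\sum_{i=1}^{t-1}p_i,$$ if $\beta=(1^{\langle k-v+p\rangle},2^{\langle l_1-p_1\rangle},\dots,t^{\langle l_{t-1}-p_{t-1}\rangle})$ with $0\le p_i\le l_i$ and $p\le v\le k$ (such $p_i,v$ are unique if they exist), and is $0$ if no such $p_i,v$ exist. For $0\le l\le kt$, the matrix $\Pi_{l,t}^{[k]}(b_0,\dots,b_t)$, with rows and columns indexed by $G_{l,t}^{[k]}$, is defined as follows. $\Pi_{0,0}^{[k]}(b_0)=k!\,b_0^k$.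 If $t\ge1$ and $\alpha=(1^{\langle l_1\rangle},\dots,t^{\langle l_t\rangle})$, its entry at $(\alpha,\beta)$ is $$k!\binom k{l_t+p}\prod_{i=1}^{t-1}\binom{l_i}{p_i}\cdot b_0^{\,k-l_t-p}\,b_1^{p_1}\cdots b_{t-1}^{p_{t-1}}\,b_t^{l_t},\qquad p=\sum_{i=1}^{t-1}p_i,$$ if $\beta=(1^{\langle l_t+p\rangle},2^{\langle l_1-p_1\rangle},\dots,t^{\langle l_{t-1}-p_{t-1}\rangle})$ with $0\le p_i\le l_i$ and $p\le k-l_t$ (such $p_i$ are unique if they exist), and is $0$ if no such $p_i$ exist. **Theorem.** Let $k\ge0$ and $0\le r\le t$, and let $a_{-r},a_{-r+1},\dots,a_{-r+t}$ be elements of a commutative ring with unity. Put $\delta=(1^{\langle k\rangle},2^{\langle k\rangle},\dots,r^{\langle k\rangle})$, let $x$ be an indeterminate, and write $M[\alpha\mid\beta]$ for the $(\alpha,\beta)$ entry of a matrix $M$. Then for all $n\ge1$ $$R\Bigl(x;\Bigl(\sum_{i=0}^t a_{-r+i}T_n^{(-r+i)}\Bigr)\otimes J_k\Bigr)=\sum_{\substack{\gamma\in\bigcup_{l=rk}^{kt}G_{l,t}^{[k]}\\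 \{\gamma\}\supseteq\{\delta\}}}\bigl(K_t^{[k]}(a_{-r}x,\dots,a_{-r+t}x)\bigr)^n[\delta\mid\gamma],$$ $$\operatorname{per}\Bigl(\Bigl(\sum_{i=0}^t a_{-r+i}T_n^{(-r+i)}\Bigr)\otimes J_k\Bigr)=\bigl(\Pi_{rk,t}^{[k]}(a_{-r},\dots,a_{-r+t})\bigr)^n[\delta\mid\delta],$$ $$R\Bigl(x;\Bigl(\sum_{i=0}^t a_{-r+i}P_n^{-r+i}\Bigr)\otimes J_k\Bigr)=\operatorname{Tr}\Bigl(\bigl(K_t^{[k]}(a_{-r}x,\dots,a_{-r+t}x)\bigr)^n\Bigr),$$ $$\operatorname{per}\Bigl(\Bigl(\sum_{i=0}^t a_{-r+i}x^iP_n^{-r+i}\Bigr)\otimes J_k\Bigr)=\sum_{l=0}^{kt}\operatorname{Tr}\Bigl(\bigl(\Pi_{l,t}^{[k]}(a_{-r},\dots,a_{-r+t})\bigr)^n\Bigr)x^{ln}.$$ -/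

import Mathlib

open Polynomial
open scoped Kronecker

/-- The nondecreasing vectors `(1^{<l_1>}, 2^{<l_2>}, …, t^{<l_t>})` with `0 ≤ l_i ≤ k`, the set
`G_t^{[k]}`. Such a vector is given by its multiplicities: for `α : GVec k t`, the value
`α i` (with `i : Fin t` counted from `0`) is the number `l_{i+1}` of components equal to `i + 1`. -/
abbrev GVec (k t : ℕ) : Type := Fin t → Fin (k + 1)

/-- The length `l_1 + ⋯ + l_t` of the vector `(1^{<l_1>}, …, t^{<l_t>})`. -/
def GVec.size {k t : ℕ} (α : GVec k t) : ℕ := ∑ i, (α i : ℕ)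

/-- The set `G_{r,t}^{[k]}` of the vectors of `G_t^{[k]}` of length `r`. -/
abbrev GVecOf (k r t : ℕ) : Type := {α : GVec k t // α.size = r}

/-- The vector `(1^{<k>}, 2^{<k>}, …, r^{<k>})`, as an element of `G_t^{[k]}` (for `r ≤ t`). -/
def fullVec (k r t : ℕ) : GVec k t := fun i => if (i : ℕ) < r then Fin.last k else 0

theorem fullVec_size {k r t : ℕ} (h : r ≤ t) : (fullVec k r t).size = r * k := by
  have h1 : ∀ i : Fin t, ((fullVec k r t i : Fin (k + 1)) : ℕ) = if (i : ℕ) < r then k else 0 := by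
    intro i
    unfold fullVec
    split_ifs <;> simp
  unfold GVec.size
  rw [Finset.sum_congr rfl (fun i _ => h1 i),
    Fin.sum_univ_eq_sum_range (fun i => if i < r then k else 0) t, ← Finset.sum_filter]
  have h2 : (Finset.range t).filter (fun i => i < r) = Finset.range r := by
    ext i
    simp only [Finset.mem_filter, Finset.mem_range]
    omega
  rw [h2]
  simp

/-- The vector `(1^{<k>}, …, r^{<k>})`, as an element of `G_{rk,t}^{[k]}`. -/
def fullVecOf (k : ℕ) {r t : ℕ} (h : r ≤ t) : GVecOf k (r * k) t :=
  ⟨fullVec k r t, fullVec_size h⟩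

/-- The matrix `K_t^{[k]}(a_0, …, a_t)` on `G_t^{[k]}`. For `t = t' + 1`, the row
`α = (1^{<l_1>}, …, t^{<l_t>})` and the column `β`, at most one choice of `p_1, …, p_{t-1}, v`
satisfies the condition of the `if`, so the sum is the value for this choice if it exists,
and `0` otherwise. Here `p j` is `p_{j+1}` and `l_{j+1}` is `α j.castSucc` for `j : Fin t'`. -/
def KMat {S : Type*} [CommRing S] (k : ℕ) :
    (t : ℕ) → (Fin (t + 1) → S) → Matrix (GVec k t) (GVec k t) S
  | 0, a => fun _ _ =>
      ∑ d ∈ Finset.range (k + 1), (d.factorial : S) * (k.choose d : S) ^ 2 * a 0 ^ d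
  | t' + 1, a => fun α β =>
      ∑ p : Fin t' → Fin (k + 1), ∑ v : Fin (k + 1),
        if (∀ j, (p j : ℕ) ≤ α j.castSucc) ∧ ∑ j, (p j : ℕ) ≤ v ∧
            (β 0 : ℕ) = k - v + ∑ j, (p j : ℕ) ∧
            ∀ j : Fin t', (β j.succ : ℕ) = α j.castSucc - p j
        then
          (∏ j : Fin t', ((α j.castSucc : ℕ).choose (p j) : S)) *
            (k.choose (v - ∑ j, (p j : ℕ)) : S) * a 0 ^ ((v : ℕ) - ∑ j, (p j : ℕ)) *
            (∏ j : Fin t', a j.succ.castSucc ^ (p j : ℕ)) *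
            ∑ d ∈ Finset.range (min (α (Fin.last t') : ℕ) (k - v) + 1),
              ((d + v).factorial : S) * (k.choose (d + v) : S) *
                ((α (Fin.last t') : ℕ).choose d : S) * a (Fin.last (t' + 1)) ^ d
        else 0

/-- The matrix `Π_{r,t}^{[k]}(a_0, …, a_t)` on `G_{r,t}^{[k]}`. As for `KMat`, at most one choice
of `p_1, …, p_{t-1}` satisfies the condition of the `if`. -/
def PiMat {S : Type*} [CommRing S] (k r : ℕ) :
    (t : ℕ) → (Fin (t + 1) → S) → Matrix (GVecOf k r t) (GVecOf k r t) S
  | 0, a => fun _ _ => (k.factorial : S) * a 0 ^ k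
  | t' + 1, a => fun α β =>
      ∑ p : Fin t' → Fin (k + 1),
        if (∀ j, (p j : ℕ) ≤ α.1 j.castSucc) ∧
            ∑ j, (p j : ℕ) ≤ k - (α.1 (Fin.last t') : ℕ) ∧
            (β.1 0 : ℕ) = α.1 (Fin.last t') + ∑ j, (p j : ℕ) ∧
            ∀ j : Fin t', (β.1 j.succ : ℕ) = α.1 j.castSucc - p j
        then
          (k.factorial : S) * (k.choose (α.1 (Fin.last t') + ∑ j, (p j : ℕ)) : S) *
            (∏ j : Fin t', ((α.1 j.castSucc : ℕ).choose (p j) : S)) *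
            a 0 ^ (k - (α.1 (Fin.last t') : ℕ) - ∑ j, (p j : ℕ)) *
            (∏ j : Fin t', a j.succ.castSucc ^ (p j : ℕ)) *
            a (Fin.last (t' + 1)) ^ (α.1 (Fin.last t') : ℕ)
        else 0

/-- The matrix `T_n^{(d)}`, with entry `1` where `j - i = d` and `0` elsewhere. -/
def toeplitzT (S : Type*) [CommRing S] (n : ℕ) (d : ℤ) : Matrix (Fin n) (Fin n) S :=
  Matrix.of fun i j => if ((j : ℕ) : ℤ) - ((i : ℕ) : ℤ) = d then 1 else 0

/-- The cyclic permutation matrix `P_n`, with entry `1` where `j - i ≡ 1 (mod n)`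
and `0` elsewhere. -/
def circP (S : Type*) [CommRing S] (n : ℕ) : Matrix (Fin n) (Fin n) S :=
  Matrix.of fun i j => if ((j : ℕ) : ℤ) - ((i : ℕ) : ℤ) ≡ 1 [ZMOD n] then 1 else 0

/-- The `k × k` matrix `J_k` of ones. -/
def onesJ (S : Type*) [CommRing S] (k : ℕ) : Matrix (Fin k) (Fin k) S :=
  Matrix.of fun _ _ => 1

/-- The rook polynomial `R(x; A) = 1 + ∑_{s ≥ 1} x^s ∑_{|I| = s} ∑_{σ : I ↪ columns}
∏_{i ∈ I} a_{i,σ(i)}`, with the indeterminate `X` as `x`. The term `1` is that of `I = ∅`. -/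
noncomputable def rookPoly {S : Type*} [CommRing S] {m n : Type*} [Fintype m] [DecidableEq m]
    [Fintype n] [DecidableEq n] (A : Matrix m n S) : S[X] :=
  ∑ I : Finset m, X ^ I.card * C (∑ σ : I ↪ n, ∏ i : I, A i (σ i))

/-! A placement is built one column block at a time. Column block `j` meets only the row blocks `j +
r - m` with `0 ≤ m ≤ t`, so it suffices to remember how many rows are still free in each of the `t`
row blocks that were opened earlier and can still be reached. This record is the vector `α`, and `K`
and `Π` are the transfer matrices of the process.

The `k` rows of a block are interchangeable, so row block `i` contributes `(e + ∑ j, A i j * X j) ^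
k`, with `e = 1` if rows may be omitted and `e = 0` for the permanent. A linear functional then
replaces `X j ^ d` by the number of ways to place `d` rows in the `k` columns of block `j`
(`rookPoly_kronecker_onesJ`; in `permanent_kronecker_onesJ` only `d = k` counts). It is
multiplicative over distinct variables, so it turns a product of matrices `colMat`, each in its own
variable, into a power of `K` or `Π` (`umbral_ofFn_prod_apply`).

What remains is an identity of polynomials. The successive numbers of free rows of one row block are
linked by binomial coefficients, and the iterated binomial theorem sums them to the `k`-th power
above. For circulants, the sum over closed walks factors over row blocks (`trace_colMat_prod`). For
Toeplitz bands, `δ` supplies the first `r` row blocks, and the end condition keeps untouched the `r`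
phantom blocks beyond the last row (`umbral_band`). In the last identity the powers of `x` are
collected by rescaling with `x` to the sum of the components (`trace_PiMat_pow_X`). -/

namespace RookTransfer

/-! ### Functionals that are multiplicative over distinct variables -/

section Umbral

variable {S : Type*} [CommRing S] {J : Type*} [Fintype J]

/-- The linear functional sending `X ^ d` to `w d`. -/
noncomputable def umbralOne (w : ℕ → S) : S[X] →ₗ[S] S :=
  (Polynomial.basisMonomials S).constr S w

/-- The linear functional sending `∏ j, X j ^ e j` to `∏ j, w (e j)`. -/
noncomputable def umbral (w : ℕ → S) : MvPolynomial J S →ₗ[S] S :=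
  (MvPolynomial.basisMonomials J S).constr S (fun e => ∏ j, w (e j))

theorem umbralOne_C_mul_X_pow (w : ℕ → S) (c : S) (d : ℕ) :
    umbralOne w (C c * X ^ d) = c * w d := by
  have h : umbralOne w (X ^ d : S[X]) = w d := by
    have := (Polynomial.basisMonomials S).constr_basis S w d
    simpa [umbralOne, Polynomial.coe_basisMonomials, ← Polynomial.X_pow_eq_monomial] using this
  rw [← Polynomial.smul_eq_C_mul, map_smul, h, smul_eq_mul]

theorem umbral_monomial (w : ℕ → S) (e : J →₀ ℕ) (c : S) :
    umbral w (MvPolynomial.monomial e c) = c * ∏ j, w (e j) := by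
  have h : umbral w (MvPolynomial.monomial e (1 : S)) = ∏ j, w (e j) := by
    have := (MvPolynomial.basisMonomials J S).constr_basis S (fun e => ∏ j, w (e j)) e
    simpa [umbral, MvPolynomial.coe_basisMonomials] using this
  have h2 : MvPolynomial.monomial e c = c • MvPolynomial.monomial e (1 : S) := by
    rw [MvPolynomial.smul_monomial, smul_eq_mul, mul_one]
  rw [h2, map_smul, h, smul_eq_mul]

theorem umbral_C_mul_prod_X_pow (w : ℕ → S) (d : J → ℕ) (c : S) :
    umbral w (MvPolynomial.C c * ∏ j, MvPolynomial.X j ^ d j) = c * ∏ j, w (d j) := by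
  have h : MvPolynomial.C c * ∏ j, MvPolynomial.X j ^ d j =
      MvPolynomial.monomial (Finsupp.equivFunOnFinite.symm d) c := by
    rw [MvPolynomial.monomial_eq, Finsupp.prod_fintype _ _ (by simp)]
    simp
  rw [h, umbral_monomial]
  simp

theorem umbral_prod_aeval [DecidableEq J] (w : ℕ → S) (p : J → S[X]) :
    umbral w (∏ j, aeval (MvPolynomial.X j : MvPolynomial J S) (p j)) =
      ∏ j, umbralOne w (p j) := by
  obtain ⟨N, hN⟩ : ∃ N, ∀ j, (p j).natDegree < N :=
    ⟨∑ j, (p j).natDegree + 1, fun j => Nat.lt_succ_of_le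
      (Finset.single_le_sum (f := fun j => (p j).natDegree) (fun _ _ => Nat.zero_le _)
        (Finset.mem_univ j))⟩
  have h1 : ∀ j, p j = ∑ d ∈ Finset.range N, C ((p j).coeff d) * X ^ d :=
    fun j => (p j).as_sum_range_C_mul_X_pow' (hN j)
  have h2 : ∀ j, umbralOne w (p j) = ∑ d ∈ Finset.range N, (p j).coeff d * w d := by
    intro j
    conv_lhs => rw [h1 j]
    rw [map_sum]
    exact Finset.sum_congr rfl fun d _ => umbralOne_C_mul_X_pow w _ _
  have h3 : ∀ j, aeval (MvPolynomial.X j : MvPolynomial J S) (p j) =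
      ∑ d ∈ Finset.range N, MvPolynomial.C ((p j).coeff d) * MvPolynomial.X j ^ d := by
    intro j
    conv_lhs => rw [h1 j]
    simp [MvPolynomial.algebraMap_eq]
  simp_rw [h2, h3, Finset.prod_univ_sum, map_sum, Finset.prod_mul_distrib]
  refine Finset.sum_congr rfl fun d _ => ?_
  rw [← map_prod, umbral_C_mul_prod_X_pow]

end Umbral

/-! ### Matrix products as sums over walks -/

section Paths

variable {G A : Type*} [Fintype G] [DecidableEq G] [CommRing A]

/-- The matrices may differ from step to step because step `j` will carry its own variable `X j`. -/
theorem ofFn_prod_apply (n : ℕ) (M : Fin n → Matrix G G A) (α β : G) :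
    (List.ofFn M).prod α β = ∑ c : Fin (n + 1) → G,
      if c 0 = α ∧ c (Fin.last n) = β then ∏ i, M i (c i.castSucc) (c i.succ) else 0 := by
  induction n generalizing α with
  | zero =>
    rw [← (Equiv.funUnique (Fin 1) G).symm.sum_comp]
    simp [Matrix.one_apply, ite_and]
  | succ n ih =>
    rw [List.ofFn_succ, List.prod_cons, Matrix.mul_apply]
    simp_rw [ih]
    rw [← (Fin.consEquiv (fun _ : Fin (n + 2) => G)).sum_comp, Fintype.sum_prod_type]
    symm
    rw [Finset.sum_eq_single α]
    · simp_rw [Finset.mul_sum]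
      conv_rhs => rw [Finset.sum_comm]
      refine Finset.sum_congr rfl fun c _ => ?_
      symm
      rw [Finset.sum_eq_single (c 0)]
      · simp only [Fin.consEquiv_apply, true_and, ← Fin.succ_last, Fin.cons_succ, Fin.cons_zero,
          Fin.prod_univ_succ, Fin.castSucc_zero, ← Fin.succ_castSucc, mul_ite, mul_zero]
      · intro b _ hb
        rw [if_neg (fun h => hb h.1.symm), mul_zero]
      · simp
    · intro b _ hb
      refine Finset.sum_eq_zero fun c _ => if_neg fun h => hb ?_
      simpa using h.1
    · simp

/-- Addition in `Fin (n + 1)` wraps around, so the last factor closes the walk. -/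
theorem trace_ofFn_prod (n : ℕ) (M : Fin (n + 1) → Matrix G G A) :
    (List.ofFn M).prod.trace = ∑ c : Fin (n + 1) → G, ∏ i, M i (c i) (c (i + 1)) := by
  simp only [Matrix.trace, Matrix.diag_apply, ofFn_prod_apply]
  rw [Finset.sum_comm, ← (Fin.snocEquiv (fun _ : Fin (n + 2) => G)).sum_comp,
    Fintype.sum_prod_type, Finset.sum_comm]
  refine Finset.sum_congr rfl fun c _ => ?_
  have h0 : ∀ x : G, (Fin.snoc c x : Fin (n + 2) → G) 0 = c 0 := fun x => by
    rw [← Fin.castSucc_zero, Fin.snoc_castSucc]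
  rw [Finset.sum_eq_single (c 0)]
  · rw [Finset.sum_eq_single (c 0)]
    · simp only [Fin.snocEquiv_apply, h0, Fin.snoc_last, and_self, if_true, Fin.snoc_castSucc]
      refine Finset.prod_congr rfl fun i _ => ?_
      congr 1
      induction i using Fin.lastCases with
      | last => rw [Fin.succ_last, Fin.snoc_last, Fin.last_add_one]
      | cast j => rw [Fin.succ_castSucc, Fin.snoc_castSucc, Fin.coeSucc_eq_succ]
    · intro b _ hb
      rw [if_neg]
      simp only [Fin.snocEquiv_apply, h0]
      exact fun h => hb h.1.symm
    · simp
  · intro x _ hx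
    refine Finset.sum_eq_zero fun b _ => if_neg ?_
    simp only [Fin.snocEquiv_apply, h0, Fin.snoc_last]
    exact fun h => hx (h.2.trans h.1.symm)
  · simp

/-- Along a fixed walk the factors involve distinct variables, so the functional acts on each entry
separately; afterwards all steps carry the same matrix. -/
theorem umbral_ofFn_prod_apply {S : Type*} [CommRing S] (w : ℕ → S) (n : ℕ)
    (M : Matrix G G S[X]) (α β : G) :
    umbral w ((List.ofFn fun j : Fin n =>
        M.map (aeval (MvPolynomial.X j : MvPolynomial (Fin n) S))).prod α β) =
      (M.map (umbralOne w) ^ n) α β := by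
  have h : M.map (umbralOne w) ^ n = (List.ofFn fun _ : Fin n => M.map (umbralOne w)).prod := by
    rw [List.ofFn_const, List.prod_replicate]
  rw [h, ofFn_prod_apply, ofFn_prod_apply, map_sum]
  refine Finset.sum_congr rfl fun c _ => ?_
  split_ifs
  · simp only [Matrix.map_apply]
    exact umbral_prod_aeval w _
  · exact map_zero _

end Paths

/-! ### The transfer matrix of a column block and its products -/

section ColumnMatrix

variable {A : Type*} [CommRing A] {k t : ℕ}

/-- The coefficient of `y ^ l'` in `(y + c) ^ l`. -/
def pascal (c : A) (l l' : ℕ) : A := (l.choose l' : A) * c ^ (l - l')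

/-- The capacities seen by a column block: a fresh row block followed by those of `α`. -/
def withFresh (α : GVec k t) : Fin (t + 1) → Fin (k + 1) :=
  Fin.cons (α := fun _ => Fin (k + 1)) (Fin.last k) α

@[simp] theorem withFresh_zero (α : GVec k t) : withFresh α 0 = Fin.last k := rfl

@[simp] theorem withFresh_succ (α : GVec k t) (i : Fin t) : withFresh α i.succ = α i := rfl

/-- The transfer matrix of one column block, where `u m` marks a row of the `m`-th row block used by
the column block, and `e` marks a row that is left unused for good. -/
def colMat (k t : ℕ) (e : A) (u : ℕ → A) : Matrix (GVec k t) (GVec k t) A := fun α β =>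
  (∏ m : Fin t, pascal (u m) (withFresh α m.castSucc) (β m)) *
    (e + u t) ^ (withFresh α (Fin.last t) : ℕ)

theorem colMat_map {B : Type*} [CommRing B] (f : A →+* B) (e : A) (u : ℕ → A) :
    (colMat k t e u).map f = colMat k t (f e) (fun m => f (u m)) := by
  ext α β
  simp [colMat, pascal, map_prod]

theorem sum_pascal_mul_pow (c y : A) {l : ℕ} (hl : l ≤ k) :
    ∑ l' : Fin (k + 1), pascal c l l' * y ^ (l' : ℕ) = (y + c) ^ l := by
  rw [Fin.sum_univ_eq_sum_range (fun l' => pascal c l l' * y ^ l') (k + 1), add_pow]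
  symm
  refine Finset.sum_subset_zero_on_sdiff (Finset.range_mono (by omega)) ?_ ?_
  · intro x hx
    simp only [Finset.mem_sdiff, Finset.mem_range, not_lt] at hx
    simp [pascal, Nat.choose_eq_zero_of_lt (show l < x by omega)]
  · intro x _
    simp only [pascal]
    ring

/-- This is the history of a single row block with `s` rows, `l m` of them still free after step
`m`. Summing over everything after the first step gives a power of `e + ∑ u (m + 1)` by induction,
and one more binomial theorem adds `u 0`. -/
theorem sum_pascal_chain (e : A) (t : ℕ) (u : ℕ → A) (s : Fin (k + 1)) :
    ∑ l : Fin t → Fin (k + 1),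
        (∏ m : Fin t, pascal (u m)
          (Fin.cons (α := fun _ => Fin (k + 1)) s l m.castSucc : Fin (k + 1)) (l m)) *
        (e + u t) ^ ((Fin.cons (α := fun _ => Fin (k + 1)) s l (Fin.last t) : Fin (k + 1)) : ℕ) =
      (e + ∑ m ∈ Finset.range (t + 1), u m) ^ (s : ℕ) := by
  induction t generalizing u s with
  | zero => simp
  | succ t ih =>
    rw [← (Fin.consEquiv (fun _ : Fin (t + 1) => Fin (k + 1))).sum_comp, Fintype.sum_prod_type]
    have key : ∀ x : Fin (k + 1), _ := fun x => ih (fun m => u (m + 1)) x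
    rw [Finset.sum_range_succ' _ (t + 1), ← add_assoc, ← sum_pascal_mul_pow _ _ s.is_le]
    refine Finset.sum_congr rfl fun x _ => ?_
    rw [← key x, Finset.mul_sum]
    refine Finset.sum_congr rfl fun l _ => ?_
    rw [Fin.prod_univ_succ, mul_assoc]
    simp [← Fin.succ_last]

open Fin.NatCast in
/-- The trace of a cyclic product of transfer matrices. -/
theorem trace_colMat_prod (e : A) (N : ℕ) (u : Fin (N + 1) → ℕ → A) :
    (List.ofFn fun i => colMat k t e (u i)).prod.trace =
      ∏ j : Fin (N + 1), (e + ∑ m ∈ Finset.range (t + 1), u (j + (m : Fin (N + 1))) m) ^ k := by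
  rw [trace_ofFn_prod]
  -- Reindexing by row blocks: `l j m` counts the free rows, after step `j + m`, of the row block
  -- opened at step `j`. It is component `m` of the state at time `j + m + 1`.
  let shift : (Fin (N + 1) → Fin t → Fin (k + 1)) ≃ (Fin (N + 1) → Fin t → Fin (k + 1)) :=
    { toFun := fun l i m => l (i - ((m : ℕ) : Fin (N + 1)) - 1) m
      invFun := fun c j m => c (j + ((m : ℕ) : Fin (N + 1)) + 1) m
      left_inv := fun l => by
        funext j m
        exact congrArg (fun i => l i m) (by abel : j + ((m : ℕ) : Fin (N + 1)) + 1 -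
          ((m : ℕ) : Fin (N + 1)) - 1 = j)
      right_inv := fun c => by
        funext j m
        exact congrArg (fun i => c i m) (by abel : j - ((m : ℕ) : Fin (N + 1)) - 1 +
          ((m : ℕ) : Fin (N + 1)) + 1 = j) }
  have hfresh : ∀ (l : Fin (N + 1) → Fin t → Fin (k + 1)) (i : Fin (N + 1)) (m : Fin (t + 1)),
      withFresh (shift l i) m = withFresh (l (i - ((m : ℕ) : Fin (N + 1)))) m := by
    intro l i m
    induction m using Fin.cases with
    | zero => rfl
    | succ m =>
      simp only [withFresh_succ, shift, Equiv.coe_fn_mk, Fin.val_succ, Nat.cast_add, Nat.cast_one]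
      congr 1
      abel
  have hnext : ∀ (l : Fin (N + 1) → Fin t → Fin (k + 1)) (i : Fin (N + 1)) (m : Fin t),
      shift l (i + 1) m = l (i - ((m : ℕ) : Fin (N + 1))) m := by
    intro l i m
    simp only [shift, Equiv.coe_fn_mk]
    congr 1
    abel
  have hsub : ∀ (a : Fin (N + 1)) (F : Fin (N + 1) → A), ∏ i, F i = ∏ j, F (j + a) := fun a F =>
    (Equiv.prod_comp (Equiv.addRight a) F).symm
  calc _ = ∑ l : Fin (N + 1) → Fin t → Fin (k + 1), ∏ j : Fin (N + 1),
        (∏ m : Fin t, pascal (u (j + ((m : ℕ) : Fin (N + 1))) m)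
          (withFresh (l j) m.castSucc) (l j m)) *
          (e + u (j + (t : Fin (N + 1))) t) ^ (withFresh (l j) (Fin.last t) : ℕ) := by
        rw [← shift.sum_comp]
        refine Finset.sum_congr rfl fun l _ => ?_
        simp only [colMat, Finset.prod_mul_distrib, hfresh, hnext]
        congr 1
        · rw [Finset.prod_comm]
          conv_rhs => rw [Finset.prod_comm]
          refine Finset.prod_congr rfl fun m _ => ?_
          rw [hsub ((m : ℕ) : Fin (N + 1))]
          simp
        · rw [hsub (t : Fin (N + 1))]
          simp
    _ = _ := by
        -- Each factor now depends on the history `l j` of one row block only, so the sum factors.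
        rw [← Fintype.prod_sum (fun (j : Fin (N + 1)) (l : Fin t → Fin (k + 1)) =>
          (∏ m : Fin t, pascal (u (j + ((m : ℕ) : Fin (N + 1))) m)
          (withFresh l m.castSucc) (l m)) *
          (e + u (j + (t : Fin (N + 1))) t) ^ (withFresh l (Fin.last t) : ℕ))]
        refine Finset.prod_congr rfl fun j _ => ?_
        exact sum_pascal_chain e t (fun m => u (j + (m : Fin (N + 1))) m) (Fin.last k)

/-- `y ^ l`, where `none` stands for the linear functional extracting the coefficient of `y ^ k`. -/
def powOrTop (k : ℕ) : Option A → ℕ → A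
  | none, l => if l = k then 1 else 0
  | some y, l => y ^ l

theorem sum_pascal_mul_powOrTop (c : A) (y : Option A) {l : ℕ} (hl : l ≤ k) :
    ∑ l' : Fin (k + 1), pascal c l l' * powOrTop k y l' = powOrTop k (y.map (· + c)) l := by
  cases y with
  | some y => exact sum_pascal_mul_pow c y hl
  | none =>
    rw [Finset.sum_eq_single (Fin.last k)]
    · rcases hl.lt_or_eq with h | rfl
      · simp [powOrTop, pascal, Nat.choose_eq_zero_of_lt h, h.ne]
      · simp [powOrTop, pascal]
    · intro b _ hb
      have : (b : ℕ) ≠ k := fun h => hb (Fin.ext h)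
      simp [powOrTop, this]
    · simp

/-- The vector with entries `∏ m, y m ^ α m`. -/
def powVec (k t : ℕ) (y : ℕ → Option A) : GVec k t → A := fun α => ∏ m : Fin t, powOrTop k (y m) (α m)

/-- Vectors of powers stay vectors of powers: the binomial theorem replaces `y m` by `y m + u m`,
and ageing moves the result to index `m - 1`. The fresh block, with all `k` rows, yields the scalar.
The condition on `y t` makes the block that leaves fit the same pattern. -/
theorem colMat_mulVec_powVec (e : A) (u : ℕ → A) (y : ℕ → Option A) (hy : y t = some e) :
    (colMat k t e u).mulVec (powVec k t y) =
      powOrTop k ((y 0).map (· + u 0)) k •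
        powVec k t (fun m => (y (m + 1)).map (· + u (m + 1))) := by
  funext α
  have h1 : ((colMat k t e u).mulVec (powVec k t y)) α =
      ∏ m : Fin (t + 1), powOrTop k ((y m).map (· + u m)) (withFresh α m) := by
    rw [Fin.prod_univ_castSucc]
    simp only [Matrix.mulVec, dotProduct, colMat, powVec, Fin.val_castSucc, Fin.val_last, hy]
    simp_rw [mul_right_comm _ ((e + u t) ^ _), ← Finset.prod_mul_distrib]
    rw [← Finset.sum_mul, ← Fintype.prod_sum (fun (m : Fin t) (b : Fin (k + 1)) =>
      pascal (u m) (withFresh α m.castSucc) b * powOrTop k (y m) b)]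
    congr 1
    exact Finset.prod_congr rfl fun m _ => sum_pascal_mul_powOrTop _ _ (Fin.is_le _)
  rw [h1, Fin.prod_univ_succ]
  simp [powVec]

theorem colMat_prod_mulVec_powVec (e : A) (n : ℕ) (u : ℕ → ℕ → A) (hu : ∀ s m, t < m → u s m = 0)
    (y : ℕ → Option A) (hy : ∀ m, t ≤ m → y m = some e) :
    (List.ofFn fun i : Fin n => colMat k t e (u i)).prod.mulVec (powVec k t y) =
      (∏ s ∈ Finset.range n, powOrTop k
        ((y (n - 1 - s)).map (· + ∑ v ∈ Finset.range (n - s), u (s + v) v)) k) •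
      powVec k t (fun m => (y (m + n)).map (· + ∑ s ∈ Finset.range n, u s (m + s + 1))) := by
  induction n generalizing u with
  | zero => simp [Option.map_id']
  | succ n ih =>
    rw [List.ofFn_succ, List.prod_cons, ← Matrix.mulVec_mulVec]
    have := ih (fun s => u (s + 1)) (fun s m hm => hu _ _ hm)
    simp only [Fin.val_succ, Fin.val_zero] at this ⊢
    rw [this, Matrix.mulVec_smul, colMat_mulVec_powVec, smul_smul, Finset.prod_range_succ']
    · congr 1
      · congr 1
        · refine Finset.prod_congr rfl fun s hs => ?_
          have h1 : n + 1 - 1 - (s + 1) = n - 1 - s := by omega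
          rw [h1, Nat.add_sub_add_right]
          simp only [add_right_comm]
        · rw [Option.map_map]
          have h1 : n + 1 - 1 - 0 = 0 + n := by omega
          rw [h1, tsub_zero, Finset.sum_range_succ']
          congr 2
          funext x
          simp only [Function.comp, add_assoc, zero_add]
      · congr 1
        funext m
        rw [Option.map_map]
        rw [Finset.sum_range_succ', show m + (n + 1) = m + 1 + n by ring]
        congr 2
        funext x
        simp only [Function.comp, add_assoc, zero_add, add_comm 1]
    -- The one-step lemma needs value `e` at index `t`: there the corrections have second index
    -- above `t` and vanish.
    · rw [hy _ (by omega), Option.map_some, Finset.sum_eq_zero, add_zero]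
      exact fun s _ => hu _ _ (by omega)

end ColumnMatrix

/-! ### Rook polynomials and permanents of block matrices through functionals -/

section Rook

variable {I J : Type*} [Fintype I] [Fintype J] [DecidableEq I] [DecidableEq J]

/-- Injections into `J × Fin k` over a given map into `J` split into injections of its fibres. -/
def liftEquiv (k : ℕ) (f : I → J) :
    {σ : I ↪ J × Fin k // ∀ i, (σ i).1 = f i} ≃ (∀ j, {i // f i = j} ↪ Fin k) where
  toFun σ j := ⟨fun i => (σ.1 i).2, fun x y h => Subtype.ext (σ.1.injective (Prod.ext
    ((σ.2 x).trans (x.2.trans (y.2.symm.trans (σ.2 y).symm))) h))⟩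
  invFun τ := ⟨⟨fun i => (f i, τ (f i) ⟨i, rfl⟩), fun x y h => by
    obtain ⟨h1, h2⟩ := Prod.ext_iff.1 h
    have h3 : ∀ (j : J) (hj : f x = j), τ (f x) ⟨x, rfl⟩ = τ j ⟨x, hj⟩ := by
      rintro j rfl
      rfl
    have h2' : τ (f x) ⟨x, rfl⟩ = τ (f y) ⟨y, rfl⟩ := h2
    rw [h3 _ h1] at h2'
    exact congrArg Subtype.val ((τ (f y)).injective h2')⟩, fun _ => rfl⟩
  left_inv σ := Subtype.ext (DFunLike.ext _ _ fun i => Prod.ext (σ.2 i).symm rfl)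
  right_inv τ := by
    funext j
    ext ⟨i, hi⟩
    subst hi
    rfl

/-- The weight depends only on the column blocks chosen, and the rows sent to block `j` are injected
into its `k` columns independently of the other blocks. -/
theorem sum_embedding_prod {S : Type*} [CommRing S] (k : ℕ) (A : I → J → S) :
    ∑ σ : I ↪ J × Fin k, ∏ i, A i (σ i).1 =
      ∑ f : I → J, (∏ i, A i (f i)) *
        ∏ j, (k.descFactorial (Fintype.card {i // f i = j}) : S) := by
  rw [← Finset.sum_fiberwise Finset.univ (fun (σ : I ↪ J × Fin k) i => (σ i).1)]
  refine Finset.sum_congr rfl fun f _ => ?_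
  have hcard : Fintype.card {σ : I ↪ J × Fin k // ∀ i, (σ i).1 = f i} =
      ∏ j, k.descFactorial (Fintype.card {i // f i = j}) := by
    rw [Fintype.card_congr (liftEquiv k f), Fintype.card_pi]
    simp [Fintype.card_embedding_eq]
  rw [Finset.sum_congr rfl (g := fun _ => ∏ i, A i (f i)), Finset.sum_const, nsmul_eq_mul,
    mul_comm, ← Nat.cast_prod, ← hcard, Fintype.card_subtype]
  · simp only [funext_iff]
  · intro σ hσ
    rw [← (Finset.mem_filter.1 hσ).2]

theorem umbral_prod_sum {S : Type*} [CommRing S] (w : ℕ → S) (A : I → J → S) :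
    umbral w (∏ i, ∑ j, MvPolynomial.C (A i j) * MvPolynomial.X j) =
      ∑ f : I → J, (∏ i, A i (f i)) * ∏ j, w (Fintype.card {i // f i = j}) := by
  rw [Fintype.prod_sum, map_sum]
  refine Finset.sum_congr rfl fun f _ => ?_
  rw [Finset.prod_mul_distrib, ← map_prod, ← umbral_C_mul_prod_X_pow]
  congr 2
  rw [← Finset.prod_fiberwise Finset.univ f]
  refine Finset.prod_congr rfl fun j _ => ?_
  rw [Finset.prod_congr rfl (g := fun _ => MvPolynomial.X j), Finset.prod_const,
    Fintype.card_subtype]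
  intro i hi
  rw [(Finset.mem_filter.1 hi).2]

/-- In the expanded product, `1` omits a row and `X j` sends it to column block `j`; the exponent of
`X j` is the number of rows to be placed there in distinct columns. -/
theorem rookPoly_kronecker_onesJ {S : Type*} [CommRing S] {n k : ℕ}
    (A : Matrix (Fin n) (Fin n) S) :
    rookPoly (A ⊗ₖ onesJ S k) = umbral (fun d => (k.descFactorial d : S[X]))
      (∏ i, (1 + ∑ j, MvPolynomial.C (C (A i j) * X) * MvPolynomial.X j) ^ k) := by
  have h : ∏ i, (1 + ∑ j, MvPolynomial.C (C (A i j) * X) * MvPolynomial.X j :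
        MvPolynomial (Fin n) S[X]) ^ k = ∏ i : Fin n × Fin k,
      (1 + ∑ j, MvPolynomial.C (C (A i.1 j) * X) * MvPolynomial.X j) := by
    rw [Fintype.prod_prod_type]
    simp
  rw [h, Finset.prod_one_add, map_sum, rookPoly, Finset.powerset_univ]
  refine Finset.sum_congr rfl fun I _ => ?_
  rw [← Finset.prod_coe_sort I, umbral_prod_sum _ (fun (i : I) j => C (A i.1.1 j) * X),
    ← sum_embedding_prod k (fun (i : I) j => C (A i.1.1 j) * X), map_sum, Finset.mul_sum]
  refine Finset.sum_congr rfl fun σ _ => ?_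
  rw [Finset.prod_mul_distrib, map_prod, Finset.prod_const, mul_comm]
  simp [onesJ, Matrix.kroneckerMap_apply]

theorem permanent_eq_sum_embedding {S : Type*} [CommRing S] (M : Matrix I I S) :
    M.permanent = ∑ σ : I ↪ I, ∏ i, M i (σ i) := by
  rw [← Matrix.permanent_transpose, Matrix.permanent,
    ← (Equiv.embeddingEquivOfFinite I).sum_comp]
  rfl

/-- All `n * k` rows are placed, so if some block does not receive exactly `k` rows, another
receives more than `k`, and both products vanish. -/
theorem prod_descFactorial_eq {S : Type*} [CommRing S] {n k : ℕ} (f : Fin n × Fin k → Fin n) :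
    ∏ j, (k.descFactorial (Fintype.card {i // f i = j}) : S) =
      ∏ j, if Fintype.card {i // f i = j} = k then (k.factorial : S) else 0 := by
  by_cases h : ∀ j, Fintype.card {i // f i = j} = k
  · simp [h, Nat.descFactorial_self]
  · have hsum : ∑ j, Fintype.card {i // f i = j} = ∑ _j : Fin n, k := by
      rw [← Fintype.card_sigma, Fintype.card_congr (Equiv.sigmaFiberEquiv f)]
      simp
    obtain ⟨j, hj⟩ : ∃ j, k < Fintype.card {i // f i = j} := by
      by_contra! hle
      exact h fun j => (Finset.sum_eq_sum_iff_of_le fun j _ => hle j).1 hsum j (Finset.mem_univ j)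
    rw [Finset.prod_eq_zero (Finset.mem_univ j), Finset.prod_eq_zero (Finset.mem_univ j)]
    · rw [if_neg hj.ne']
    · rw [Nat.descFactorial_of_lt hj, Nat.cast_zero]

theorem permanent_kronecker_onesJ {S : Type*} [CommRing S] {n k : ℕ}
    (A : Matrix (Fin n) (Fin n) S) :
    (A ⊗ₖ onesJ S k).permanent = umbral (fun d => if d = k then (k.factorial : S) else 0)
      -- The summand `0` stands for `e`: no row may be omitted.
      (∏ i, (0 + ∑ j, MvPolynomial.C (A i j) * MvPolynomial.X j) ^ k) := by
  have h : ∏ i, (0 + ∑ j, MvPolynomial.C (A i j) * MvPolynomial.X j :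
        MvPolynomial (Fin n) S) ^ k = ∏ i : Fin n × Fin k,
      (∑ j, MvPolynomial.C (A i.1 j) * MvPolynomial.X j) := by
    rw [Fintype.prod_prod_type]
    simp
  rw [h, umbral_prod_sum _ (fun (i : Fin n × Fin k) j => A i.1 j), permanent_eq_sum_embedding]
  simp_rw [← prod_descFactorial_eq]
  rw [← sum_embedding_prod]
  simp [onesJ, Matrix.kroneckerMap_apply]

end Rook

/-! ### Identification of `K` and `Π`, length and weight -/

section Entries

variable {S : Type*} [CommRing S] {k t : ℕ}

/-- The total number of rows that a transition from `α` to `β` takes from row blocks remaining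
available. -/
def used (α β : GVec k t) : ℕ := ∑ m : Fin t, ((withFresh α m.castSucc : ℕ) - β m)

/-- The product of the coefficients of a transition from `α` to `β`. -/
def entryCoeff (b : ℕ → S) (α β : GVec k t) : S :=
  ∏ m : Fin t, pascal (b m) (withFresh α m.castSucc) (β m)

theorem umbralOne_colMat (w : ℕ → S) (e : S) (b : ℕ → S) (α β : GVec k t) :
    umbralOne w (colMat k t (C e) (fun m => C (b m) * X) α β) =
      entryCoeff b α β * ∑ d ∈ Finset.range ((withFresh α (Fin.last t) : ℕ) + 1),
        b t ^ d * e ^ ((withFresh α (Fin.last t) : ℕ) - d) *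
          ((withFresh α (Fin.last t) : ℕ).choose d : S) * w (used α β + d) := by
  have h : colMat k t (C e) (fun m => C (b m) * X) α β =
      ∑ d ∈ Finset.range ((withFresh α (Fin.last t) : ℕ) + 1),
        C (entryCoeff b α β * (b t ^ d * e ^ ((withFresh α (Fin.last t) : ℕ) - d) *
          ((withFresh α (Fin.last t) : ℕ).choose d : S))) * X ^ (used α β + d) := by
    have h1 : ∏ m : Fin t, pascal (C (b m) * X) (withFresh α m.castSucc) (β m) =
        C (entryCoeff b α β) * X ^ used α β := by
      simp only [pascal, mul_pow, ← mul_assoc, Finset.prod_mul_distrib, Finset.prod_pow_eq_pow_sum,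
        entryCoeff, used, map_prod, map_mul, map_natCast, map_pow]
    simp only [colMat]
    rw [h1, add_comm (C e), add_pow, Finset.mul_sum]
    refine Finset.sum_congr rfl fun d _ => ?_
    simp only [map_mul, map_pow, map_natCast, mul_pow, pow_add]
    ring
  rw [h, map_sum, Finset.mul_sum]
  refine Finset.sum_congr rfl fun d _ => ?_
  rw [umbralOne_C_mul_X_pow]
  ring

theorem entryCoeff_eq_zero (b : ℕ → S) {α β : GVec k t} (m : Fin t)
    (h : (withFresh α m.castSucc : ℕ) < β m) : entryCoeff b α β = 0 :=
  Finset.prod_eq_zero (Finset.mem_univ m) (by rw [pascal, Nat.choose_eq_zero_of_lt h]; simp)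

theorem withFresh_succ_castSucc {t : ℕ} (α : GVec k (t + 1)) (j : Fin t) :
    withFresh α j.succ.castSucc = α j.castSucc := by
  rw [← Fin.succ_castSucc, withFresh_succ]

theorem withFresh_last {t : ℕ} (α : GVec k (t + 1)) :
    withFresh α (Fin.last (t + 1)) = α (Fin.last t) := by
  rw [← Fin.succ_last, withFresh_succ]

theorem used_succ {t : ℕ} (α β : GVec k (t + 1)) :
    used α β = (k - β 0) + ∑ j : Fin t, ((α j.castSucc : ℕ) - β j.succ) := by
  rw [used, Fin.sum_univ_succ]
  simp

theorem entryCoeff_succ {t : ℕ} (b : ℕ → S) (α β : GVec k (t + 1)) :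
    entryCoeff b α β = pascal (b 0) k (β 0) *
      ∏ j : Fin t, pascal (b (j + 1)) (α j.castSucc) (β j.succ) := by
  rw [entryCoeff, Fin.prod_univ_succ]
  simp

theorem pascal_eq_choose_sub (c : S) {l l' : ℕ} (h : l' ≤ l) :
    pascal c l l' = (l.choose (l - l') : S) * c ^ (l - l') := by
  rw [pascal, Nat.choose_symm h]

/-- In the definition of `K`, `p` counts the rows taken from the older blocks that remain reachable,
`v` adds those taken from the fresh block, and `d` those from the block that leaves. The pair `α`,
`β` determines `p` and `v`, so at most one term of the double sum survives. -/
theorem KMat_eq_umbralOne (b : ℕ → S) :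
    KMat k t (fun i => b i) =
      (colMat k t 1 (fun m => C (b m) * X)).map (umbralOne fun d => (k.descFactorial d : S)) := by
  ext α β
  rw [Matrix.map_apply, ← C_1, umbralOne_colMat]
  simp only [one_pow, mul_one]
  cases t with
  | zero =>
    simp only [KMat, entryCoeff, used, Finset.univ_eq_empty, Finset.prod_empty, Finset.sum_empty,
      one_mul, zero_add]
    refine Finset.sum_congr rfl fun d _ => ?_
    rw [Nat.descFactorial_eq_factorial_mul_choose]
    push_cast
    simp
    ring
  | succ t =>
    simp only [KMat]
    rw [withFresh_last]
    have hβ := (β 0).is_le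
    by_cases hle : ∀ j : Fin t, (β j.succ : ℕ) ≤ α j.castSucc
    · let q : Fin t → Fin (k + 1) := fun j =>
        ⟨(α j.castSucc : ℕ) - β j.succ, by have := (α j.castSucc).is_lt; omega⟩
      have hq : ∀ j, (q j : ℕ) = (α j.castSucc : ℕ) - β j.succ := fun _ => rfl
      rw [Finset.sum_eq_single q]
      · rw [used_succ]
        simp only [← hq]
        by_cases hv : ∑ j, (q j : ℕ) ≤ β 0
        · let v : Fin (k + 1) := ⟨k - β 0 + ∑ j, (q j : ℕ), by omega⟩
          have hvv : (v : ℕ) = k - β 0 + ∑ j, (q j : ℕ) := rfl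
          rw [Finset.sum_eq_single v]
          · rw [if_pos ⟨fun j => by rw [hq]; omega, by omega, by omega,
              fun j => by have := hle j; rw [hq]; omega⟩, ← hvv]
            have hvq : (v : ℕ) - ∑ j, (q j : ℕ) = k - β 0 := by omega
            have hsum : ∑ d ∈ Finset.range (min (α (Fin.last t) : ℕ) (k - v) + 1),
                  ((d + v).factorial : S) * (k.choose (d + v) : S) *
                    ((α (Fin.last t) : ℕ).choose d : S) * b (Fin.last (t + 1)) ^ d =
                ∑ d ∈ Finset.range ((α (Fin.last t) : ℕ) + 1), b (t + 1) ^ d *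
                    ((α (Fin.last t) : ℕ).choose d : S) * (k.descFactorial (v + d) : S) := by
              refine Finset.sum_subset_zero_on_sdiff (Finset.range_mono (by omega)) ?_ ?_
              · intro d hd
                simp only [Finset.mem_sdiff, Finset.mem_range] at hd
                rw [Nat.descFactorial_of_lt (by omega), Nat.cast_zero, mul_zero]
              · intro d _
                rw [Nat.descFactorial_eq_factorial_mul_choose, add_comm (v : ℕ)]
                push_cast
                ring
            rw [hsum, hvq, entryCoeff_succ, pascal_eq_choose_sub _ hβ]
            congr 1
            have hprod : ∏ j : Fin t, pascal (b (j + 1)) (α j.castSucc) (β j.succ) =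
                (∏ j, ((α j.castSucc : ℕ).choose (q j) : S)) * ∏ j : Fin t, b (j + 1) ^ (q j : ℕ) := by
              rw [← Finset.prod_mul_distrib]
              exact Finset.prod_congr rfl fun j _ => by rw [pascal_eq_choose_sub _ (hle j), hq]
            rw [hprod]
            simp only [Fin.val_zero, Fin.val_castSucc, Fin.val_succ]
            ring
          · intro v' _ hv'
            refine if_neg fun h => hv' (Fin.ext ?_)
            have := v'.is_le
            omega
          · simp
        · rw [Finset.sum_eq_zero, Finset.sum_eq_zero, mul_zero]
          · intro d _
            rw [Nat.descFactorial_of_lt (by omega), Nat.cast_zero, mul_zero]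
          · intro v' _
            refine if_neg fun h => hv ?_
            have := v'.is_le
            omega
      · intro p _ hp
        refine Finset.sum_eq_zero fun v' _ => if_neg fun h => hp (funext fun j => Fin.ext ?_)
        have h1 := h.1 j
        have h2 := h.2.2.2 j
        rw [hq]
        omega
      · simp
    · push Not at hle
      obtain ⟨j, hj⟩ := hle
      rw [entryCoeff_eq_zero b j.succ (by rwa [withFresh_succ_castSucc]), zero_mul]
      refine Finset.sum_eq_zero fun p _ => Finset.sum_eq_zero fun v' _ => if_neg fun h => ?_
      have := h.2.2.2 j
      omega

/-- The transfer matrix for the permanent, on all of `GVec k t`. -/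
noncomputable def fullPiMat (k t : ℕ) (b : ℕ → S) : Matrix (GVec k t) (GVec k t) S :=
  (colMat k t 0 (fun m => C (b m) * X)).map
    (umbralOne fun d => if d = k then (k.factorial : S) else 0)

/-- With `e = 0` every free row of the block that leaves must be used, so only the top value of `d`
survives. -/
theorem fullPiMat_apply (b : ℕ → S) (α β : GVec k t) :
    fullPiMat k t b α β = entryCoeff b α β * b t ^ (withFresh α (Fin.last t) : ℕ) *
      if used α β + withFresh α (Fin.last t) = k then (k.factorial : S) else 0 := by
  rw [fullPiMat, Matrix.map_apply, ← C_0, umbralOne_colMat, Finset.sum_eq_single_of_mem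
    (withFresh α (Fin.last t) : ℕ) (Finset.self_mem_range_succ _)]
  · simp
    ring_nf
  · intro d hd hne
    rw [Finset.mem_range] at hd
    rw [zero_pow (by omega)]
    simp

theorem sum_withFresh_castSucc (α : GVec k t) :
    ∑ m : Fin t, (withFresh α m.castSucc : ℕ) + withFresh α (Fin.last t) = k + α.size := by
  rw [← Fin.sum_univ_castSucc (fun m => (withFresh α m : ℕ)), Fin.sum_univ_succ]
  simp [GVec.size]

theorem used_add_size {α β : GVec k t} (h : ∀ m, (β m : ℕ) ≤ withFresh α m.castSucc) :
    used α β + withFresh α (Fin.last t) + β.size = k + α.size := by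
  rw [← sum_withFresh_castSucc, used, GVec.size, add_right_comm, ← Finset.sum_add_distrib]
  congr 1
  exact Finset.sum_congr rfl fun m _ => Nat.sub_add_cancel (h m)

/-- Each step opens `k` rows and uses exactly `k`, so the number of free rows is conserved. -/
theorem fullPiMat_eq_zero_of_size_ne (b : ℕ → S) {α β : GVec k t} (h : α.size ≠ β.size) :
    fullPiMat k t b α β = 0 := by
  rw [fullPiMat_apply]
  by_cases hle : ∀ m, (β m : ℕ) ≤ withFresh α m.castSucc
  · have := used_add_size hle
    rw [if_neg (by omega), mul_zero]
  · push Not at hle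
    obtain ⟨m, hm⟩ := hle
    rw [entryCoeff_eq_zero b m hm]
    simp

theorem PiMat_apply_eq_fullPiMat (b : ℕ → S) {l : ℕ} (α β : GVecOf k l t) :
    PiMat k l t (fun i => b i) α β = fullPiMat k t b α.1 β.1 := by
  rw [fullPiMat_apply]
  cases t with
  | zero => simp [PiMat, entryCoeff, used, mul_comm, withFresh]
  | succ t =>
    simp only [PiMat]
    rw [withFresh_last]
    obtain ⟨α, hα⟩ := α
    obtain ⟨β, hβ'⟩ := β
    simp only
    have hβ := (β 0).is_le
    have hα' := (α (Fin.last t)).is_le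
    by_cases hle : ∀ j : Fin t, (β j.succ : ℕ) ≤ α j.castSucc
    · let q : Fin t → Fin (k + 1) := fun j =>
        ⟨(α j.castSucc : ℕ) - β j.succ, by have := (α j.castSucc).is_lt; omega⟩
      have hq : ∀ j, (q j : ℕ) = (α j.castSucc : ℕ) - β j.succ := fun _ => rfl
      have hus := used_succ α β
      -- Since `α` and `β` have the same length, exactly `k` rows are used, so the indicator in
      -- `fullPiMat_apply` is satisfied.
      have hsz : used α β + withFresh α (Fin.last (t + 1)) + β.size = k + α.size := by
        refine used_add_size fun m => ?_
        induction m using Fin.cases with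
        | zero => simpa using hβ
        | succ j => rw [withFresh_succ_castSucc]; exact hle j
      rw [withFresh_last] at hsz
      simp only [← hq] at hus
      rw [Finset.sum_eq_single q]
      · rw [if_pos ⟨fun j => by rw [hq]; omega, by omega, by omega,
              fun j => by have := hle j; rw [hq]; omega⟩, if_pos (by omega)]
        have hprod : ∏ j : Fin t, pascal (b (j + 1)) (α j.castSucc) (β j.succ) =
            (∏ j, ((α j.castSucc : ℕ).choose (q j) : S)) * ∏ j : Fin t, b (j + 1) ^ (q j : ℕ) := by
          rw [← Finset.prod_mul_distrib]
          exact Finset.prod_congr rfl fun j _ => by rw [pascal_eq_choose_sub _ (hle j), hq]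
        rw [entryCoeff_succ, hprod, pascal,
          show (α (Fin.last t) : ℕ) + ∑ j, (q j : ℕ) = β 0 by omega,
          show k - (α (Fin.last t) : ℕ) - ∑ j, (q j : ℕ) = k - β 0 by omega]
        simp only [Fin.val_zero, Fin.val_castSucc, Fin.val_succ, Fin.val_last]
        ring
      · intro p _ hp
        refine if_neg fun h => hp (funext fun j => Fin.ext ?_)
        have h1 := h.1 j
        have h2 := h.2.2.2 j
        rw [hq]
        omega
      · simp
    · push Not at hle
      obtain ⟨j, hj⟩ := hle
      rw [entryCoeff_eq_zero b j.succ (by rwa [withFresh_succ_castSucc]), zero_mul, zero_mul]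
      refine Finset.sum_eq_zero fun p _ => if_neg fun h => ?_
      have := h.2.2.2 j
      omega

/-- Walks never leave a length level, so powers can be taken on each level separately. -/
theorem PiMat_pow_apply (b : ℕ → S) {l : ℕ} (n : ℕ) (α β : GVecOf k l t) :
    (PiMat k l t (fun i => b i) ^ n) α β = (fullPiMat k t b ^ n) α.1 β.1 := by
  induction n generalizing β with
  | zero => simp [Matrix.one_apply, Subtype.ext_iff]
  | succ n ih =>
    rw [pow_succ, pow_succ, Matrix.mul_apply, Matrix.mul_apply,
      ← Finset.sum_filter_of_ne (p := fun x : GVec k t => x.size = l),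
      Finset.sum_subtype (p := fun x : GVec k t => x.size = l) _ (by simp)]
    · exact Finset.sum_congr rfl fun x _ => by rw [ih, PiMat_apply_eq_fullPiMat]
    · intro x _ hx
      by_contra hne
      exact hx (by rw [fullPiMat_eq_zero_of_size_ne b (fun h => hne (h.trans β.2)), mul_zero])

theorem size_le (α : GVec k t) : α.size ≤ k * t :=
  (Finset.sum_le_card_nsmul _ _ k fun i _ => (α i).is_le).trans (by simp [mul_comm])

theorem trace_fullPiMat_pow (b : ℕ → S) (n : ℕ) :
    (fullPiMat k t b ^ n).trace =
      ∑ l ∈ Finset.range (k * t + 1), (PiMat k l t (fun i => b i) ^ n).trace := by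
  simp only [Matrix.trace, Matrix.diag_apply]
  rw [← Finset.sum_fiberwise_of_maps_to (s := Finset.univ) (t := Finset.range (k * t + 1))
    (g := GVec.size) (fun α _ => Finset.mem_range_succ_iff.2 (size_le α))]
  refine Finset.sum_congr rfl fun l _ => ?_
  rw [Finset.sum_subtype (p := fun x : GVec k t => x.size = l) _ (by simp)]
  exact Finset.sum_congr rfl fun α _ => (PiMat_pow_apply b n α α).symm

/-- The sum of the components of `(1^{<l_1>}, …, t^{<l_t>})`. -/
def weight (α : GVec k t) : ℕ := ∑ m : Fin t, ((m : ℕ) + 1) * (α m : ℕ)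

/-- Fresh rows have component `0`, a row used at component `m` removes `m` from the weight, and
every surviving row ages by one. -/
theorem weight_step {α β : GVec k t} (h : ∀ m, (β m : ℕ) ≤ withFresh α m.castSucc) :
    ∑ m : Fin t, (m : ℕ) * ((withFresh α m.castSucc : ℕ) - β m) +
      t * (withFresh α (Fin.last t) : ℕ) + weight β = weight α + β.size := by
  have h1 : weight α = ∑ m : Fin t, (m : ℕ) * (withFresh α m.castSucc : ℕ) +
      t * (withFresh α (Fin.last t) : ℕ) := by
    have := Fin.sum_univ_castSucc (fun m : Fin (t + 1) => (m : ℕ) * (withFresh α m : ℕ))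
    rw [Fin.sum_univ_succ] at this
    simpa [weight] using this
  have h2 : weight β = ∑ m : Fin t, (m : ℕ) * (β m : ℕ) + β.size := by
    simp only [weight, GVec.size, ← Finset.sum_add_distrib, add_mul, one_mul]
  have h3 : ∑ m : Fin t, (m : ℕ) * ((withFresh α m.castSucc : ℕ) - β m) +
      ∑ m : Fin t, (m : ℕ) * (β m : ℕ) = ∑ m : Fin t, (m : ℕ) * (withFresh α m.castSucc : ℕ) := by
    rw [← Finset.sum_add_distrib]
    exact Finset.sum_congr rfl fun m _ => by rw [← mul_add, Nat.sub_add_cancel (h m)]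
  omega

theorem X_pow_mul_fullPiMat (b : ℕ → S) (α β : GVec k t) :
    X ^ weight β * fullPiMat k t (fun m => C (b m) * X ^ m) α β =
      X ^ (weight α + β.size) * C (fullPiMat k t b α β) := by
  by_cases h : ∀ m, (β m : ℕ) ≤ withFresh α m.castSucc
  · have h1 : entryCoeff (fun m => C (b m) * X ^ m : ℕ → S[X]) α β =
        X ^ (∑ m : Fin t, (m : ℕ) * ((withFresh α m.castSucc : ℕ) - β m)) *
          C (entryCoeff b α β) := by
      simp only [entryCoeff, map_prod, ← Finset.prod_pow_eq_pow_sum, ← Finset.prod_mul_distrib]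
      refine Finset.prod_congr rfl fun m _ => ?_
      simp only [pascal, map_mul, map_pow, map_natCast]
      ring
    rw [← weight_step h, fullPiMat_apply, fullPiMat_apply, h1]
    have h2 : (if used α β + withFresh α (Fin.last t) = k then (k.factorial : S[X]) else 0) =
        C (if used α β + withFresh α (Fin.last t) = k then (k.factorial : S) else 0) := by
      split_ifs <;> simp
    rw [h2]
    simp only [map_mul, map_pow]
    ring
  · push Not at h
    obtain ⟨m, hm⟩ := h
    simp only [fullPiMat_apply, entryCoeff_eq_zero _ m hm]
    simp

/-- Conjugation by the diagonal matrix of `X ^ weight`, written without inverses: the weights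
telescope along a walk, and each step leaves a factor `X ^ l`. -/
theorem X_pow_mul_PiMat_pow (b : ℕ → S) {l : ℕ} (n : ℕ) (α β : GVecOf k l t) :
    X ^ weight β.1 * (PiMat k l t (fun i => C (b i) * X ^ (i : ℕ)) ^ n) α β =
      X ^ (weight α.1 + l * n) * C ((PiMat k l t (fun i => b i) ^ n) α β) := by
  induction n generalizing β with
  | zero =>
    by_cases h : α = β
    · simp [h]
    · simp [Matrix.one_apply_ne h]
  | succ n ih =>
    rw [pow_succ, pow_succ, Matrix.mul_apply, Matrix.mul_apply, map_sum, Finset.mul_sum,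
      Finset.mul_sum]
    refine Finset.sum_congr rfl fun x _ => ?_
    have h1 := X_pow_mul_fullPiMat b x.1 β.1
    rw [← PiMat_apply_eq_fullPiMat, ← PiMat_apply_eq_fullPiMat, β.2] at h1
    rw [map_mul]
    linear_combination (PiMat k l t (fun i => C (b i) * X ^ (i : ℕ)) ^ n) α x * h1 +
      X ^ l * C (PiMat k l t (fun i => b i) x β) * ih x

theorem trace_PiMat_pow_X (b : ℕ → S) (l n : ℕ) :
    (PiMat k l t (fun i => C (b i) * X ^ (i : ℕ)) ^ n).trace =
      C (PiMat k l t (fun i => b i) ^ n).trace * X ^ (l * n) := by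
  simp only [Matrix.trace, Matrix.diag_apply, map_sum, Finset.sum_mul]
  -- On the diagonal the factor `X ^ weight` is the same on both sides, and it is cancellable
  -- because it is monic.
  refine Finset.sum_congr rfl fun α _ => (monic_X_pow (weight α.1)).isRegular.left ?_
  have := X_pow_mul_PiMat_pow b n α α
  simp only
  rw [this]
  ring

end Entries

/-! ### Toeplitz bands -/

section Toeplitz

variable {S : Type*} [CommRing S] {k t : ℕ}

theorem colMat_map_aeval (e : S) (b : ℕ → S) {J : Type*} (j : J) :
    (colMat k t (C e) (fun m => C (b m) * X)).map (aeval (MvPolynomial.X j : MvPolynomial J S)) =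
      colMat k t (MvPolynomial.C e) (fun m => MvPolynomial.C (b m) * MvPolynomial.X j) := by
  have := colMat_map (k := k) (t := t)
    (aeval (MvPolynomial.X j : MvPolynomial J S)).toRingHom (C e) (fun m => C (b m) * X)
  simpa [MvPolynomial.algebraMap_eq] using this

theorem map_powOrTop {A B : Type*} [CommRing A] [CommRing B] (f : A →+* B) (y : Option A) (l : ℕ) :
    f (powOrTop k y l) = powOrTop k (y.map f) l := by
  cases y with
  | none =>
    simp only [powOrTop, Option.map_none]
    split_ifs <;> simp
  | some y => simp [powOrTop]

/-- The final conditions on the availabilities for a Toeplitz band: nothing may be used of the first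
`r` row blocks. -/
def bandEnd {A : Type*} (r : ℕ) (e : A) (m : ℕ) : Option A := if m < r then none else some e

/-- Here `f i` is the linear form of row block `i < n + r`, which meets column block `s` at index `s
+ r - i`. The initial vector supplies the blocks `i < r`, and step `s` opens block `r + s`. The
blocks `i ≥ n` are phantoms: `none` demands that all their rows stay free, which makes their factor
`1`. -/
theorem prod_powOrTop_band {A : Type*} [CommRing A] (e : A) {n r : ℕ} (hr : r ≤ t)
    (u : ℕ → ℕ → A) :
    (∏ s ∈ Finset.range n, powOrTop k
        ((bandEnd r e (n - 1 - s)).map (· + ∑ v ∈ Finset.range (n - s), u (s + v) v)) k) *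
      powVec k t (fun m => (bandEnd r e (m + n)).map
        (· + ∑ s ∈ Finset.range n, u s (m + s + 1))) (fullVec k r t) =
      ∏ i ∈ Finset.range n,
        (e + ∑ s ∈ Finset.range n, if i ≤ s + r then u s (s + r - i) else 0) ^ k := by
  set f : ℕ → A := fun i => ∑ s ∈ Finset.range n, if i ≤ s + r then u s (s + r - i) else 0 with hf
  let g : ℕ → A := fun i => powOrTop k ((if n ≤ i then none else some e).map (· + f i)) k
  have h1 : ∏ s ∈ Finset.range n, powOrTop k
      ((bandEnd r e (n - 1 - s)).map (· + ∑ v ∈ Finset.range (n - s), u (s + v) v)) k =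
      ∏ s ∈ Finset.range n, g (r + s) := by
    refine Finset.prod_congr rfl fun s hs => ?_
    rw [Finset.mem_range] at hs
    have hfs : f (r + s) = ∑ v ∈ Finset.range (n - s), u (s + v) v := by
      obtain ⟨d, rfl⟩ := Nat.exists_eq_add_of_lt hs
      rw [hf]
      simp only
      rw [show s + d + 1 = s + (d + 1) by ring, Finset.sum_range_add, Nat.add_sub_cancel_left,
        Finset.sum_eq_zero, zero_add]
      · refine Finset.sum_congr rfl fun v _ => ?_
        rw [if_pos (by omega), show s + v + r - (r + s) = v by omega]
      · intro x hx
        rw [Finset.mem_range] at hx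
        rw [if_neg (by omega)]
    simp only [g, hfs, bandEnd]
    by_cases h : n ≤ r + s
    · rw [if_pos h, if_pos (by omega)]
    · rw [if_neg h, if_neg (by omega)]
  have h2 : powVec k t (fun m => (bandEnd r e (m + n)).map
      (· + ∑ s ∈ Finset.range n, u s (m + s + 1))) (fullVec k r t) =
      ∏ i ∈ Finset.range r, g i := by
    have h3 : ∀ m : Fin t, powOrTop k ((bandEnd r e (m + n)).map
        (· + ∑ s ∈ Finset.range n, u s (m + s + 1))) (fullVec k r t m) =
        if (m : ℕ) < r then g (r - 1 - m) else 1 := by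
      intro m
      by_cases hm : (m : ℕ) < r
      · have hfm : f (r - 1 - m) = ∑ s ∈ Finset.range n, u s (m + s + 1) := by
          refine Finset.sum_congr rfl fun s _ => ?_
          rw [if_pos (by omega), show s + r - (r - 1 - m) = m + s + 1 by omega]
        simp only [fullVec, if_pos hm, Fin.val_last, g, hfm, bandEnd]
        by_cases h : (m : ℕ) + n < r
        · rw [if_pos h, if_pos (by omega)]
        · rw [if_neg h, if_neg (by omega)]
      · simp only [fullVec, if_neg hm, bandEnd]
        rw [if_neg (by omega)]
        simp [powOrTop]
    rw [powVec, Finset.prod_congr rfl fun m _ => h3 m,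
      Fin.prod_univ_eq_prod_range (fun m => if m < r then g (r - 1 - m) else 1) t,
      ← Finset.prod_filter, ← Finset.prod_range_reflect]
    congr 1
    ext i
    simp only [Finset.mem_filter, Finset.mem_range]
    omega
  -- The `r + n` row blocks are split again, into `n` genuine ones and `r` phantoms.
  rw [h1, h2, mul_comm, ← Finset.prod_range_add, add_comm r, Finset.prod_range_add,
    Finset.prod_eq_one (s := Finset.range r), mul_one]
  · refine Finset.prod_congr rfl fun i hi => ?_
    rw [Finset.mem_range] at hi
    simp only [g, if_neg (not_le.2 hi), Option.map_some, powOrTop, hf]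
  · intro i _
    simp [g, powOrTop]

/-- The band Toeplitz matrix with entry `b (j + r - i)` at `(i, j)` for `0 ≤ j + r - i ≤ t`. -/
def band (n r t : ℕ) (b : ℕ → S) : Matrix (Fin n) (Fin n) S := Matrix.of fun i j =>
  if (i : ℕ) ≤ j + r ∧ (j : ℕ) + r - i ≤ t then b (j + r - i) else 0

theorem umbral_band (w : ℕ → S) (e : S) (b : ℕ → S) {n r : ℕ} (hr : r ≤ t) :
    umbral w (∏ i, (MvPolynomial.C e +
        ∑ j, MvPolynomial.C (band n r t b i j) * MvPolynomial.X j) ^ k) =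
      ∑ γ, ((colMat k t (C e) (fun m => C (b m) * X)).map (umbralOne w) ^ n) (fullVec k r t) γ *
        powVec k t (bandEnd r e) γ := by
  -- The cutoff at `t` is what `colMat_prod_mulVec_powVec` requires; `colMat` never reads beyond it.
  let u : ℕ → ℕ → MvPolynomial (Fin n) S := fun s m =>
    if h : s < n then if m ≤ t then MvPolynomial.C (b m) * MvPolynomial.X ⟨s, h⟩ else 0 else 0
  have hend : ∀ m, (bandEnd r e m).map (MvPolynomial.C (σ := Fin n)) =
      bandEnd r (MvPolynomial.C e) m := by
    intro m
    simp only [bandEnd]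
    split_ifs <;> simp
  have hcol : ∀ j : Fin n,
      colMat k t (MvPolynomial.C e) (fun m => MvPolynomial.C (b m) * MvPolynomial.X j) =
      colMat k t (MvPolynomial.C e) (u j) := by
    intro j
    ext α β
    simp only [colMat, u, dif_pos j.is_lt, le_refl, if_true]
    congr 2
    refine Finset.prod_congr rfl fun m _ => ?_
    rw [if_pos m.is_lt.le]
  have hrow : ∀ i : Fin n, ∑ j, MvPolynomial.C (band n r t b i j) * MvPolynomial.X j =
      ∑ s ∈ Finset.range n, if (i : ℕ) ≤ s + r then u s (s + r - i) else 0 := by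
    intro i
    rw [← Fin.sum_univ_eq_sum_range (fun s => if (i : ℕ) ≤ s + r then u s (s + r - i) else 0) n]
    refine Finset.sum_congr rfl fun j _ => ?_
    simp only [band, Matrix.of_apply, u, dif_pos j.is_lt]
    split_ifs <;> simp_all
  simp_rw [← umbral_ofFn_prod_apply, colMat_map_aeval, hcol, hrow]
  rw [Fin.prod_univ_eq_prod_range (fun i => (MvPolynomial.C e + ∑ s ∈ Finset.range n,
    if i ≤ s + r then u s (s + r - i) else 0) ^ k) n, ← prod_powOrTop_band _ hr]
  have h := congrFun (colMat_prod_mulVec_powVec (k := k) (t := t) (MvPolynomial.C e) n u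
    (fun s m hm => by simp [u, not_le.2 hm]) (bandEnd r (MvPolynomial.C e))
    (fun m hm => by simp [bandEnd, not_lt.2 (hr.trans hm)])) (fullVec k r t)
  rw [Pi.smul_apply, smul_eq_mul] at h
  rw [← h, Matrix.mulVec, dotProduct, map_sum]
  refine Finset.sum_congr rfl fun γ _ => ?_
  have hv : powVec k t (bandEnd r (MvPolynomial.C e : MvPolynomial (Fin n) S)) γ =
      MvPolynomial.C (powVec k t (bandEnd r e) γ) := by
    simp only [powVec, map_prod, map_powOrTop, hend]
  rw [hv, mul_comm, ← MvPolynomial.smul_eq_C_mul, map_smul, smul_eq_mul, mul_comm]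

/-- With `e = 1` the blocks of index at least `r` are unconstrained at the end. -/
theorem powVec_bandEnd_one {r : ℕ} (γ : GVec k t) :
    powVec k t (bandEnd r (1 : S)) γ = if ∀ i, fullVec k r t i ≤ γ i then 1 else 0 := by
  have h : ∀ i : Fin t, powOrTop k (bandEnd r (1 : S) i) (γ i) =
      if fullVec k r t i ≤ γ i then 1 else 0 := by
    intro i
    by_cases hi : (i : ℕ) < r
    · simp only [fullVec, bandEnd, if_pos hi, powOrTop, Fin.last_le_iff, Fin.ext_iff, Fin.val_last]
    · simp [fullVec, bandEnd, hi, powOrTop]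
  simp only [powVec, h]
  split_ifs with hall
  · exact Finset.prod_eq_one fun i _ => if_pos (hall i)
  · push Not at hall
    obtain ⟨i, hi⟩ := hall
    exact Finset.prod_eq_zero (Finset.mem_univ i) (if_neg (not_le.2 hi))

/-- With `e = 0` the blocks of index at least `r` must be exhausted, since `0 ^ l` vanishes unless
`l = 0`. -/
theorem powVec_bandEnd_zero {r : ℕ} (γ : GVec k t) :
    powVec k t (bandEnd r (0 : S)) γ = if γ = fullVec k r t then 1 else 0 := by
  have h : ∀ i : Fin t, powOrTop k (bandEnd r (0 : S) i) (γ i) =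
      if γ i = fullVec k r t i then 1 else 0 := by
    intro i
    by_cases hi : (i : ℕ) < r
    · simp only [fullVec, bandEnd, if_pos hi, powOrTop, Fin.ext_iff, Fin.val_last]
    · simp only [fullVec, bandEnd, if_neg hi, powOrTop, zero_pow_eq, Fin.ext_iff, Fin.val_zero]
  simp only [powVec, h, funext_iff]
  split_ifs with hall
  · exact Finset.prod_eq_one fun i _ => if_pos (hall i)
  · push Not at hall
    obtain ⟨i, hi⟩ := hall
    exact Finset.prod_eq_zero (Finset.mem_univ i) (if_neg hi)

theorem sum_smul_toeplitzT (n r t : ℕ) (a : ℤ → S) :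
    ∑ i : Fin (t + 1), a (-(r : ℤ) + (i : ℕ)) • toeplitzT S n (-(r : ℤ) + (i : ℕ)) =
      band n r t (fun m => a (-(r : ℤ) + (m : ℕ))) := by
  ext i j
  simp only [Matrix.sum_apply, Matrix.smul_apply, toeplitzT, Matrix.of_apply, band, smul_eq_mul,
    mul_ite, mul_one, mul_zero]
  split_ifs with h
  · rw [Finset.sum_eq_single ⟨j + r - i, by omega⟩]
    · rw [if_pos]
      push_cast [h.1]
      ring
    · intro m _ hm
      refine if_neg fun h' => hm (Fin.ext ?_)
      simp only
      omega
    · simp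
  · refine Finset.sum_eq_zero fun m _ => if_neg fun h' => h ?_
    have := m.is_le
    omega

end Toeplitz

/-! ### Circulants -/

section Circulant

variable {S : Type*} [CommRing S] {k t : ℕ}

theorem sum_fin_natCast {M : Type*} [AddCommMonoid M] (N : ℕ) (f : ZMod (N + 1) → M) :
    ∑ x : Fin (N + 1), f ((x : ℕ) : ZMod (N + 1)) = ∑ z, f z :=
  Finset.sum_congr rfl fun z _ => congrArg f (ZMod.natCast_zmod_val (n := N + 1) z)

theorem sub_modEq_iff_zmod {n : ℕ} (i j : ℕ) (d : ℤ) :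
    (j : ℤ) - (i : ℤ) ≡ d [ZMOD n] ↔ (j : ZMod n) = i + d := by
  rw [← ZMod.intCast_eq_intCast_iff]
  push_cast
  rw [sub_eq_iff_eq_add, add_comm]

/-- The matrix with entry `1` where `j - i ≡ d (mod n)` and `0` elsewhere. -/
def circShift (S : Type*) [CommRing S] (n : ℕ) (d : ℤ) : Matrix (Fin n) (Fin n) S :=
  Matrix.of fun i j => if ((j : ℕ) : ℤ) - ((i : ℕ) : ℤ) ≡ d [ZMOD n] then 1 else 0

theorem circShift_mul (N : ℕ) (c d : ℤ) :
    circShift S (N + 1) c * circShift S (N + 1) d = circShift S (N + 1) (c + d) := by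
  ext i j
  simp only [Matrix.mul_apply, circShift, Matrix.of_apply, sub_modEq_iff_zmod]
  rw [sum_fin_natCast N (fun z => (if z = ((i : ℕ) : ZMod (N + 1)) + c then (1 : S) else 0) *
    if ((j : ℕ) : ZMod (N + 1)) = z + d then 1 else 0)]
  simp only [ite_mul, one_mul, zero_mul, Finset.sum_ite_eq', Finset.mem_univ, if_true, add_assoc,
    Int.cast_add]

theorem circShift_zero (N : ℕ) : circShift S (N + 1) 0 = 1 := by
  ext i j
  simp only [circShift, Matrix.of_apply, sub_modEq_iff_zmod, Int.cast_zero, add_zero,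
    Matrix.one_apply, ZMod.natCast_eq_natCast_iff', Nat.mod_eq_of_lt i.is_lt,
    Nat.mod_eq_of_lt j.is_lt, Fin.ext_iff, eq_comm]

theorem circP_zpow (N : ℕ) (d : ℤ) : circP S (N + 1) ^ d = circShift S (N + 1) d := by
  have h1 : circP S (N + 1) = circShift S (N + 1) 1 := rfl
  have hu : IsUnit (circShift S (N + 1) 1).det := by
    refine Matrix.isUnit_det_of_right_inverse (B := circShift S (N + 1) (-1)) ?_
    rw [circShift_mul, add_neg_cancel, circShift_zero]
  have hinv : (circShift S (N + 1) 1)⁻¹ = circShift S (N + 1) (-1) := by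
    refine Matrix.inv_eq_right_inv ?_
    rw [circShift_mul, add_neg_cancel, circShift_zero]
  rw [h1]
  induction d using Int.induction_on with
  | zero => rw [zpow_zero, circShift_zero]
  | succ d ih => rw [Matrix.zpow_add_one hu, ih, circShift_mul]
  | pred d ih => rw [Matrix.zpow_sub_one hu, ih, hinv, circShift_mul, sub_eq_add_neg]

open Fin.NatCast in
theorem sub_modEq_iff_fin {N : ℕ} (i j : Fin (N + 1)) (r m : ℕ) :
    ((j : ℕ) : ℤ) - ((i : ℕ) : ℤ) ≡ -(r : ℤ) + (m : ℕ) [ZMOD (N + 1 : ℕ)] ↔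
      j = i - (r : Fin (N + 1)) + (m : Fin (N + 1)) := by
  rw [sub_modEq_iff_zmod]
  have h : j = i - (r : Fin (N + 1)) + (m : Fin (N + 1)) ↔
      j + (r : Fin (N + 1)) = i + (m : Fin (N + 1)) := by
    rw [sub_add_eq_add_sub, eq_sub_iff_add_eq]
  rw [h, Fin.ext_iff, Fin.val_add, Fin.val_add, Fin.val_natCast, Fin.val_natCast, Nat.add_mod_mod,
    Nat.add_mod_mod, ← Nat.ModEq, ← ZMod.natCast_eq_natCast_iff]
  push_cast
  constructor <;> intro h <;> linear_combination h

theorem umbral_circulant (w : ℕ → S) (e : S) (b : ℕ → S) (N r : ℕ) :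
    umbral w (∏ i, (MvPolynomial.C e + ∑ j, MvPolynomial.C
        ((∑ m : Fin (t + 1), b m • circShift S (N + 1) (-(r : ℤ) + (m : ℕ))) i j) *
          MvPolynomial.X j) ^ k) =
      ((colMat k t (C e) (fun m => C (b m) * X)).map (umbralOne w) ^ (N + 1)).trace := by
  simp_rw [Matrix.trace, Matrix.diag_apply, ← umbral_ofFn_prod_apply, colMat_map_aeval]
  rw [← map_sum]
  have h := trace_colMat_prod (k := k) (t := t) (MvPolynomial.C e) N
    (fun j m => MvPolynomial.C (b m) * (MvPolynomial.X j : MvPolynomial (Fin (N + 1)) S))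
  rw [Matrix.trace] at h
  simp only [Matrix.diag_apply] at h
  rw [h]
  -- The offset `-r` only renumbers the row blocks cyclically, which the product over all of them
  -- does not see.
  open Fin.NatCast in
  rw [← Equiv.prod_comp (Equiv.addRight (r : Fin (N + 1)))]
  congr 1
  refine Finset.prod_congr rfl fun i _ => ?_
  congr 2
  simp only [Matrix.sum_apply, Matrix.smul_apply, circShift, Matrix.of_apply, sub_modEq_iff_fin,
    Equiv.coe_addRight, add_sub_cancel_right, smul_eq_mul, map_sum, Finset.sum_mul]
  open Fin.NatCast in
  rw [Finset.sum_comm, Fin.sum_univ_eq_sum_range (fun m => ∑ j, MvPolynomial.C (b m *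
    if j = i + (m : Fin (N + 1)) then (1 : S) else 0) *
      (MvPolynomial.X j : MvPolynomial (Fin (N + 1)) S)) (t + 1)]
  refine Finset.sum_congr rfl fun m _ => ?_
  rw [Finset.sum_eq_single_of_mem _ (Finset.mem_univ _)]
  · rw [if_pos rfl, mul_one]
  · intro j _ hj
    rw [if_neg hj]
    simp

end Circulant

end RookTransfer

/-! ### The four identities -/

theorem theorem3 {R : Type*} [CommRing R] (k r t : ℕ) (hrt : r ≤ t) (a : ℤ → R)
    (n : ℕ) (hn : 1 ≤ n) :
    (rookPoly ((∑ i : Fin (t + 1), a (-(r : ℤ) + (i : ℕ)) • toeplitzT R n (-(r : ℤ) + (i : ℕ)))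
          ⊗ₖ onesJ R k) =
      ∑ γ : GVec k t with (r * k ≤ γ.size ∧ γ.size ≤ k * t) ∧ (∀ i, fullVec k r t i ≤ γ i),
        (KMat k t (fun i => C (a (-(r : ℤ) + (i : ℕ))) * X) ^ n) (fullVec k r t) γ) ∧
    (((∑ i : Fin (t + 1), a (-(r : ℤ) + (i : ℕ)) • toeplitzT R n (-(r : ℤ) + (i : ℕ)))
          ⊗ₖ onesJ R k).permanent =
      (PiMat k (r * k) t (fun i => a (-(r : ℤ) + (i : ℕ))) ^ n)
        (fullVecOf k hrt) (fullVecOf k hrt)) ∧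
    (rookPoly ((∑ i : Fin (t + 1), a (-(r : ℤ) + (i : ℕ)) • circP R n ^ (-(r : ℤ) + (i : ℕ)))
          ⊗ₖ onesJ R k) =
      (KMat k t (fun i => C (a (-(r : ℤ) + (i : ℕ))) * X) ^ n).trace) ∧
    (((∑ i : Fin (t + 1),
          (C (a (-(r : ℤ) + (i : ℕ))) * X ^ (i : ℕ)) • circP R[X] n ^ (-(r : ℤ) + (i : ℕ)))
          ⊗ₖ onesJ R[X] k).permanent =
      ∑ l ∈ Finset.range (k * t + 1),
        C (PiMat k l t (fun i => a (-(r : ℤ) + (i : ℕ))) ^ n).trace * X ^ (l * n)) := by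
  open RookTransfer in
  obtain ⟨N, rfl⟩ : ∃ N, n = N + 1 := ⟨n - 1, by omega⟩
  -- The rook polynomial variable is absorbed into the coefficients, so the transfer matrix lives
  -- over `R[X]`.
  have hK := KMat_eq_umbralOne (k := k) (t := t) (fun m : ℕ => C (a (-(r : ℤ) + (m : ℕ))) * X)
  refine ⟨?_, ?_, ?_, ?_⟩
  · have hband : ∀ i j, C (band (N + 1) r t (fun m => a (-(r : ℤ) + (m : ℕ))) i j) * X =
        band (N + 1) r t (fun m => C (a (-(r : ℤ) + (m : ℕ))) * X) i j := by
      intro i j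
      simp only [band, Matrix.of_apply]
      split_ifs <;> simp
    rw [sum_smul_toeplitzT, rookPoly_kronecker_onesJ, ← (MvPolynomial.C).map_one]
    simp_rw [hband]
    rw [umbral_band _ _ _ hrt, C_1, ← hK, Finset.sum_filter]
    refine Finset.sum_congr rfl fun γ _ => ?_
    rw [powVec_bandEnd_one]
    by_cases hγ : ∀ i, fullVec k r t i ≤ γ i
    -- The bounds on the length of `γ` follow from its containing `δ`.
    · have hsize : r * k ≤ γ.size := by
        rw [← fullVec_size hrt]
        exact Finset.sum_le_sum fun i _ => hγ i
      rw [if_pos hγ, if_pos ⟨⟨hsize, size_le γ⟩, hγ⟩, mul_one]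
    · rw [if_neg hγ, if_neg (fun h => hγ h.2), mul_zero]
  · rw [sum_smul_toeplitzT, permanent_kronecker_onesJ, ← (MvPolynomial.C).map_zero,
      umbral_band _ _ _ hrt]
    simp_rw [powVec_bandEnd_zero]
    rw [PiMat_pow_apply (fun m => a (-(r : ℤ) + (m : ℕ))), fullPiMat, C_0]
    simp [fullVecOf]
  · have hcirc := umbral_circulant (k := k) (t := t) (fun d => (k.descFactorial d : R[X])) 1
      (fun m : ℕ => C (a (-(r : ℤ) + (m : ℕ))) * X) N r
    rw [C_1] at hcirc
    rw [rookPoly_kronecker_onesJ, ← (MvPolynomial.C).map_one, hK, ← hcirc]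
    simp_rw [circP_zpow]
    congr! 8 with i _ j
    simp only [Matrix.sum_apply, Matrix.smul_apply, map_sum, smul_eq_mul, Finset.sum_mul]
    refine Finset.sum_congr rfl fun m _ => ?_
    simp only [circShift, Matrix.of_apply]
    split_ifs <;> simp
  · rw [permanent_kronecker_onesJ, ← (MvPolynomial.C).map_zero]
    simp_rw [circP_zpow]
    rw [umbral_circulant _ _ (fun m : ℕ => C (a (-(r : ℤ) + (m : ℕ))) * X ^ m) N r, C_0,
      ← fullPiMat, trace_fullPiMat_pow]
    exact Finset.sum_congr rfl fun l _ =>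
      trace_PiMat_pow_X (fun m : ℕ => a (-(r : ℤ) + (m : ℕ))) l (N + 1)
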